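/- Let $\mathcal{H}$ be an infinite-dimensional complex Hilbert space and let $\mathcal{I}$ be an index set with at least $3$ elements. A contractive $C_0$-semigroup on $\mathcal{H}$ is a family $(T(t))_{t\ge 0}$ of bounded operators with $T(0)=1$, $T(s+t)=T(s)T(t)$, $\|T(t)\|\le 1$, and $t\mapsto T(t)\xi$ continuous for every $\xi\in\mathcal{H}$; its generator is the operator $A\xi=\lim_{t\to0^+}t^{-1}(T(t)\xi-\xi)$, defined on all $\xi$ for which the limit exists. A family $\{T_i\}_{i\in\mathcal{I}}$ of such semigroups is commuting if $T_i(s)T_j(t)=T_j(t)T_i(s)$ for all $i,j\in\mathcal{I}$ and $s,t\ge 0$. A commuting family $\{T_i\}_{i\in\mathcal{I}}$ has a simultaneous unitary dilation if there are a Hilbert space $\mathcal{H}'$, a commuting family $\{U_i\}_{i\in\mathcal{I}}$ of strongly continuous unitary representations of $\mathbb{R}$ on $\mathcal{H}'$ and an isometry $r:\mathcal{H}\to\mathcal{H}'$ such that $$\prod_{i\in\mathcal{I}}T_i(t_i)=r^{\ast}\Big(\prod_{i\in\mathcal{I}}U_i(t_i)\Big)r$$ for all finitely supported families $(t_i)_{i\in\mathcal{I}}$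 of non-negative reals. Then there exists a commuting family $\{T_i\}_{i\in\mathcal{I}}$ of contractive $C_0$-semigroups on $\mathcal{H}$ that admits no simultaneous unitary dilation. Furthermore, the $T_i$ can be chosen to have bounded generators (i.e. each generator is an everywhere defined bounded operator on $\mathcal{H}$). -/

import Mathlib

open Filter Topology
open scoped NNReal InnerProduct

universe u v w

/-- A contractive `C₀`-semigroup on a complex Hilbert space `H`: a strongly continuous
one-parameter semigroup of contractions, indexed by the non-negative reals. -/
structure ContractiveC0Semigroup (H : Type u) [NormedAddCommGroup H] [InnerProductSpace ℂ H] where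
  /-- The operator at time `t`. -/
  op : ℝ≥0 → H →L[ℂ] H
  op_zero : op 0 = 1
  op_add : ∀ s t, op (s + t) = op s * op t
  norm_op_le : ∀ t, ‖op t‖ ≤ 1
  continuous_op : ∀ x, Continuous fun t => op t x

namespace ContractiveC0Semigroup

variable {H : Type u} [NormedAddCommGroup H] [InnerProductSpace ℂ H]

/-- The difference quotient `t⁻¹ (T(t) x - x)`. -/
noncomputable def diffQuot (T : ContractiveC0Semigroup H) (x : H) (t : ℝ≥0) : H :=
  ((t : ℝ) : ℂ)⁻¹ • (T.op t x - x)

theorem diffQuot_add {T : ContractiveC0Semigroup H} {x y a b : H}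
    (hx : Tendsto (T.diffQuot x) (𝓝[>] 0) (𝓝 a)) (hy : Tendsto (T.diffQuot y) (𝓝[>] 0) (𝓝 b)) :
    Tendsto (T.diffQuot (x + y)) (𝓝[>] 0) (𝓝 (a + b)) := by
  refine (hx.add hy).congr fun t => ?_
  simp only [diffQuot, map_add, ← smul_add]
  congr 1
  abel

theorem diffQuot_smul {T : ContractiveC0Semigroup H} (c : ℂ) {x a : H}
    (hx : Tendsto (T.diffQuot x) (𝓝[>] 0) (𝓝 a)) :
    Tendsto (T.diffQuot (c • x)) (𝓝[>] 0) (𝓝 (c • a)) := by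
  refine (hx.const_smul c).congr fun t => ?_
  simp only [diffQuot, map_smul, ← smul_sub]
  exact smul_comm _ _ _

/-- The (infinitesimal) generator of a semigroup `T`: the partially defined linear operator
`x ↦ lim_{t → 0+} t⁻¹ (T(t) x - x)`, whose domain consists of all `x` for which the limit exists. -/
noncomputable def generator (T : ContractiveC0Semigroup H) : H →ₗ.[ℂ] H where
  domain :=
    { carrier := {x | ∃ y, Tendsto (T.diffQuot x) (𝓝[>] 0) (𝓝 y)}
      add_mem' := fun ⟨_, ha⟩ ⟨_, hb⟩ => ⟨_, diffQuot_add ha hb⟩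
      zero_mem' := ⟨0, by
        have h : T.diffQuot 0 = fun _ => 0 := by funext t; simp [diffQuot]
        rw [h]; exact tendsto_const_nhds⟩
      smul_mem' := fun c _ ⟨_, ha⟩ => ⟨_, diffQuot_smul c ha⟩ }
  toFun :=
    { toFun := fun x => Classical.choose x.2
      map_add' := fun x y => tendsto_nhds_unique (Classical.choose_spec (x + y).2)
        (diffQuot_add (Classical.choose_spec x.2) (Classical.choose_spec y.2))
      map_smul' := fun c x => tendsto_nhds_unique (Classical.choose_spec (c • x).2)
        (diffQuot_smul c (Classical.choose_spec x.2)) }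

/-- The generator is an everywhere defined bounded operator. -/
def HasBoundedGenerator (T : ContractiveC0Semigroup H) : Prop :=
  ∃ A : H →L[ℂ] H, T.generator = (A : H →ₗ[ℂ] H).toPMap ⊤

end ContractiveC0Semigroup

/-- A strongly continuous unitary representation of the additive group `ℝ` on a Hilbert space. -/
structure UnitaryRepReal (K : Type w) [NormedAddCommGroup K] [InnerProductSpace ℂ K]
    [CompleteSpace K] where
  /-- The operator at the group element `t`. -/
  op : ℝ → K →L[ℂ] K
  op_mem_unitary : ∀ t, op t ∈ unitary (K →L[ℂ] K)
  op_zero : op 0 = 1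
  op_add : ∀ s t, op (s + t) = op s * op t
  continuous_op : ∀ x, Continuous fun t => op t x

section Families

variable {ι : Type v} {X : Type*} {E : Type*} [NormedAddCommGroup E] [InnerProductSpace ℂ E]

/-- A family of operator-valued functions is commuting if all values of its members commute. -/
def CommutingFamily (F : ι → X → E →L[ℂ] E) : Prop :=
  ∀ i j s t, Commute (F i s) (F j t)

/-- The product `∏_{i ∈ s} F_i(t_i)` for a commuting family `F` and a finite set `s` of indices. -/
def CommutingFamily.prod {F : ι → X → E →L[ℂ] E} (hF : CommutingFamily F) (s : Finset ι)
    (t : ι → X) : E →L[ℂ] E :=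
  s.noncommProd (fun i => F i (t i)) fun i _ j _ _ => hF i j (t i) (t j)

end Families

/-- The commuting family `T` of contractive `C₀`-semigroups on `H` has a simultaneous unitary
dilation: there are a Hilbert space `K`, a commuting family `U` of strongly continuous unitary
representations of `ℝ` on `K` and an isometry `r : H → K` such that
`∏ T_i(t_i) = r* (∏ U_i(t_i)) r` for all finitely supported families `t` of non-negative reals. -/
def HasSimultaneousUnitaryDilation {H : Type u} [NormedAddCommGroup H] [InnerProductSpace ℂ H]
    [CompleteSpace H] {ι : Type v} (T : ι → ContractiveC0Semigroup H)
    (hT : CommutingFamily fun i => (T i).op) : Prop :=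
  ∃ (K : Type w) (_ : NormedAddCommGroup K) (_ : InnerProductSpace ℂ K) (_ : CompleteSpace K)
    (U : ι → UnitaryRepReal K) (hU : CommutingFamily fun i => (U i).op) (r : H →ₗᵢ[ℂ] K),
    ∀ t : ι →₀ ℝ≥0,
      hT.prod t.support t =
        (ContinuousLinearMap.adjoint r.toContinuousLinearMap) ∘L
          (hU.prod t.support fun i => (t i : ℝ)) ∘L r.toContinuousLinearMap

/-! This is Parrott's example in continuous time. Take orthogonal isometric copies of `ℂ²` in `H`,
with embeddings J₀ and J₁, and let V_i map J₀ x to J₁ (u_i x) and kill the complement of the range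
of J₀, with u_i unitary. All products V_i V_j vanish, so the semigroups e⁻ᵗ(1 + 2tV_i) commute
whatever the u_i are; `norm_one_add_two_mul_smul_le_exp` makes them contractive.

Given a dilation, the Möbius transforms M_i of U_i(t) at a = e⁻ᵗ are commuting isometries that
compress to sV_i with s ≥ a (`compression_mobius`, `mobius_squareZero`). Since s is nearly 1, M_i r
J₀ x lies within √(2t)‖x‖ of r J₁ u_i x. If some u_c is 1, commutativity of the M_i bounds the
commutators of the u_i by a multiple of √t (`norm_commutator_le`), and t → 0 makes the u_i commute.
Two noncommuting unitaries and the identity contradict this, which is where three indices enter. -/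

/-! ### Semigroups of square-zero contractions -/

/-- A square-zero contraction `V` satisfies `‖1 + 2tV‖ ≤ eᵗ` for `t ≥ 0`. -/
theorem norm_one_add_two_mul_smul_le_exp {H : Type*} [NormedAddCommGroup H]
    [InnerProductSpace ℂ H] [CompleteSpace H] {V : H →L[ℂ] H} (hV : V * V = 0) (hn : ‖V‖ ≤ 1)
    {t : ℝ} (ht : 0 ≤ t) : ‖1 + ((2 * t : ℝ) : ℂ) • V‖ ≤ Real.exp t := by
  refine ContinuousLinearMap.opNorm_le_bound _ (Real.exp_pos t).le fun x => ?_
  -- Since V² = 0, V l lies in ker V and is therefore orthogonal to l.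
  obtain ⟨k, hk, l, hl, rfl⟩ := (LinearMap.ker (V : H →ₗ[ℂ] H)).exists_add_mem_mem_orthogonal x
  have hVk : V k = 0 := hk
  have hVV : V (V l) = 0 := congrArg (fun f : H →L[ℂ] H => f l) hV
  have hkl : inner ℂ k l = 0 := hl k hk
  have hlVl : inner ℂ l (V l) = 0 := by
    rw [← inner_conj_symm, hl (V l) hVV, map_zero]
  have hp : ‖V l‖ ≤ ‖l‖ := by
    simpa using (V.le_opNorm l).trans (mul_le_mul_of_nonneg_right hn (norm_nonneg l))
  have hN : ‖k + l‖ ^ 2 = ‖k‖ ^ 2 + ‖l‖ ^ 2 := by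
    rw [@norm_add_sq ℂ, hkl]; simp
  have hre : RCLike.re (inner ℂ k (V l)) ≤ ‖k‖ * ‖l‖ :=
    (re_inner_le_norm k (V l)).trans (by gcongr)
  have hL : ‖(1 + ((2 * t : ℝ) : ℂ) • V) (k + l)‖ ^ 2
      = ‖k‖ ^ 2 + ‖l‖ ^ 2 + 4 * t * RCLike.re (inner ℂ k (V l)) + 4 * t ^ 2 * ‖V l‖ ^ 2 := by
    have h1 : (1 + ((2 * t : ℝ) : ℂ) • V) (k + l) = (k + l) + ((2 * t : ℝ) : ℂ) • V l := by
      simp [hVk]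
    have h2 : RCLike.re (inner ℂ (k + l) (((2 * t : ℝ) : ℂ) • V l))
        = 2 * t * RCLike.re (inner ℂ k (V l)) := by
      rw [inner_smul_right, inner_add_left, hlVl, add_zero]
      exact Complex.re_ofReal_mul _ _
    rw [h1, @norm_add_sq ℂ, h2, norm_smul, mul_pow, hN, Complex.norm_real, Real.norm_eq_abs,
      sq_abs]
    ring
  have hsinh : t ≤ Real.sinh t := Real.self_le_sinh_iff.2 ht
  set E := Real.exp t with hE
  have hE1 : 1 + t ≤ E := by rw [add_comm]; exact Real.add_one_le_exp t
  have hE0 : 0 < E := Real.exp_pos t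
  have hlam : 2 * t * E ≤ E ^ 2 - 1 := by
    rw [Real.sinh_eq, Real.exp_neg, ← hE] at hsinh
    have : 2 * t ≤ E - E⁻¹ := by linarith
    calc 2 * t * E ≤ (E - E⁻¹) * E := by gcongr
      _ = E ^ 2 - 1 := by field_simp
  refine le_of_sq_le_sq ?_ (by positivity)
  rw [mul_pow, hN, hL]
  have hp0 := norm_nonneg l
  have hq0 := norm_nonneg k
  have hVl0 := norm_nonneg (V l)
  generalize ‖V l‖ = m at *
  generalize ‖l‖ = p at *
  generalize ‖k‖ = q at *
  have h1 : 4 * t * RCLike.re (inner ℂ k (V l)) ≤ 4 * t * (q * p) := by gcongr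
  have h2 : 4 * t ^ 2 * m ^ 2 ≤ 4 * t ^ 2 * p ^ 2 := by gcongr
  rcases ht.eq_or_lt with rfl | ht0
  · simp [hE]
  have hl0 : 0 < E ^ 2 - 1 := lt_of_lt_of_le (by positivity) hlam
  have hsq : 4 * t ^ 2 * E ^ 2 ≤ (E ^ 2 - 1) ^ 2 := by
    calc 4 * t ^ 2 * E ^ 2 = (2 * t * E) ^ 2 := by ring
      _ ≤ _ := by gcongr
  -- With D = E² - 1 the right side is (2tp - Dq)² + (D² - 4t²E²)p².
  have key : 0 ≤ (E ^ 2 - 1) * ((E ^ 2 - 1) * (q ^ 2 + p ^ 2) - 4 * t * (q * p)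
      - 4 * t ^ 2 * p ^ 2) := by
    nlinarith [sq_nonneg (2 * t * p - (E ^ 2 - 1) * q), mul_le_mul_of_nonneg_right hsq (sq_nonneg p)]
  have := nonneg_of_mul_nonneg_right key hl0
  linarith

/-- The contractive semigroup `t ↦ e⁻ᵗ (1 + 2tV)` attached to a square-zero contraction `V`. It is
generated by `2V - 1`, the Cayley transform of `-V`. -/
noncomputable def squareZeroSemigroup {H : Type*} [NormedAddCommGroup H]
    [InnerProductSpace ℂ H] [CompleteSpace H] (V : H →L[ℂ] H) (hV : V * V = 0) (hn : ‖V‖ ≤ 1) :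
    ContractiveC0Semigroup H where
  op t := ((Real.exp (-t) : ℝ) : ℂ) • (1 + ((2 * t : ℝ) : ℂ) • V)
  op_zero := by simp
  op_add s t := by
    simp only [smul_mul_smul_comm, add_mul, mul_add, one_mul, mul_one, hV, smul_zero, add_zero]
    rw [← Complex.ofReal_mul, ← Real.exp_add, add_assoc, ← add_smul]
    push_cast
    ring_nf
  norm_op_le t := by
    rw [norm_smul, Complex.norm_real, Real.norm_eq_abs, Real.abs_exp]
    calc _ ≤ Real.exp (-t) * Real.exp t := by
          gcongr; exact norm_one_add_two_mul_smul_le_exp hV hn t.2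
      _ = 1 := by rw [← Real.exp_add]; simp
  continuous_op x := by
    simp only [smul_apply, add_apply]
    fun_prop

theorem squareZeroSemigroup_hasBoundedGenerator {H : Type*} [NormedAddCommGroup H]
    [InnerProductSpace ℂ H] [CompleteSpace H] (V : H →L[ℂ] H) (hV : V * V = 0) (hn : ‖V‖ ≤ 1) :
    (squareZeroSemigroup V hV hn).HasBoundedGenerator := by
  have lim : ∀ x, Tendsto ((squareZeroSemigroup V hV hn).diffQuot x) (𝓝[>] 0)
      (𝓝 ((-1 + (2 : ℂ) • V) x)) := by
    intro x
    have hd : HasDerivAt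
        (fun t : ℝ => ((Real.exp (-t) : ℝ) : ℂ) • (x + ((2 * t : ℝ) : ℂ) • V x))
        ((-1 + (2 : ℂ) • V) x) 0 := by
      have h1 : HasDerivAt (fun t : ℝ => ((Real.exp (-t) : ℝ) : ℂ)) (((-1 : ℝ) : ℝ) : ℂ) 0 := by
        simpa using ((hasDerivAt_neg (0 : ℝ)).exp).ofReal_comp
      have h2 : HasDerivAt (fun t : ℝ => ((2 * t : ℝ) : ℂ)) ((2 : ℝ) : ℂ) 0 := by
        simpa using ((hasDerivAt_id (0 : ℝ)).const_mul 2).ofReal_comp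
      have h3 := h1.smul ((h2.smul_const (V x)).const_add x)
      refine h3.congr_deriv ?_
      simp [add_comm]
    have hs := hd.tendsto_slope_zero_right
    have hc : Tendsto (fun t : ℝ≥0 => (t : ℝ)) (𝓝[>] 0) (𝓝[>] 0) :=
      tendsto_nhdsWithin_iff.2 ⟨(NNReal.continuous_coe.tendsto' 0 0 rfl).mono_left
        nhdsWithin_le_nhds, eventually_mem_nhdsWithin.mono fun t ht => NNReal.coe_pos.2 ht⟩
    refine (hs.comp hc).congr fun t => ?_
    simp only [Function.comp_apply, ContractiveC0Semigroup.diffQuot, squareZeroSemigroup,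
      smul_apply, add_apply]
    simp only [← Complex.ofReal_inv, Complex.coe_smul]
    simp only [zero_add, neg_zero, Real.exp_zero, mul_zero, zero_smul,
      add_zero, one_smul, one_apply_eq_self]
  refine ⟨-1 + (2 : ℂ) • V, LinearPMap.ext ?_ ?_⟩
  · exact eq_top_iff.2 fun x _ => ⟨_, lim x⟩
  · intro x hx hx'
    exact tendsto_nhds_unique (Classical.choose_spec hx) (lim x)

/-! ### Möbius transforms and compressions -/

/-- The Möbius transform `(W - a) (1 - aW)⁻¹` of an operator `W`, with the inverse written as a
geometric series. -/
noncomputable def mobius {K : Type*} [NormedAddCommGroup K] [InnerProductSpace ℂ K]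
    (a : ℂ) (W : K →L[ℂ] K) : K →L[ℂ] K :=
  (W - a • 1) * ∑' n : ℕ, (a • W) ^ n

theorem Commute.mobius {K : Type*} [NormedAddCommGroup K] [InnerProductSpace ℂ K]
    {W W' : K →L[ℂ] K} (h : Commute W W') (a b : ℂ) : Commute (mobius a W) (mobius b W') := by
  have hs : ∀ {X Y : K →L[ℂ] K} (c : ℂ), Commute X Y → Commute X (∑' n : ℕ, (c • Y) ^ n) :=
    fun c hXY => Commute.tsum_right _ fun n => (hXY.smul_right c).pow_right n
  have hd : ∀ {X Y : K →L[ℂ] K} (c : ℂ), Commute X Y → Commute X (Y - c • 1) :=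
    fun c hXY => hXY.sub_right ((Commute.one_right _).smul_right c)
  have hm : ∀ {X Y : K →L[ℂ] K} (c : ℂ), Commute X Y → Commute X (_root_.mobius c Y) :=
    fun c hXY => (hd c hXY).mul_right (hs c hXY)
  exact (hm a (hm b h).symm).symm

theorem norm_smul_unitary_lt_one {K : Type*} [NormedAddCommGroup K] [InnerProductSpace ℂ K]
    [CompleteSpace K] {W : K →L[ℂ] K} (hW : W ∈ unitary (K →L[ℂ] K)) {a : ℝ} (h0 : 0 ≤ a)
    (h1 : a < 1) : ‖(a : ℂ) • W‖ < 1 := by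
  have : ‖W‖ ≤ 1 := 
    ContinuousLinearMap.opNorm_le_bound _ zero_le_one fun x => by
      rw [ContinuousLinearMap.norm_map_of_mem_unitary hW, one_mul]
  rw [norm_smul, Complex.norm_real, Real.norm_of_nonneg h0]
  nlinarith

/-- For `0 ≤ a < 1` the Möbius transform maps unitaries to isometries. -/
theorem norm_mobius_apply {K : Type*} [NormedAddCommGroup K] [InnerProductSpace ℂ K]
    [CompleteSpace K] {W : K →L[ℂ] K} (hW : W ∈ unitary (K →L[ℂ] K)) {a : ℝ} (h0 : 0 ≤ a)
    (h1 : a < 1) (y : K) : ‖mobius (a : ℂ) W y‖ = ‖y‖ := by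
  -- With y = (1 - aW)z the image is (W - a)z; as ‖Wz‖ = ‖z‖ and a is real, both squared norms are
  -- (1 + a²)‖z‖² - 2a Re⟨z, Wz⟩.
  set z := (∑' n : ℕ, ((a : ℂ) • W) ^ n) y with hz
  have hy : z - (a : ℂ) • W z = y := by
    have := mul_neg_geom_series _ (norm_smul_unitary_lt_one hW h0 h1)
    exact congrArg (fun f : K →L[ℂ] K => f y) this
  have hMy : mobius (a : ℂ) W y = W z - (a : ℂ) • z := by
    simp [mobius, hz]
  have hWz : ‖W z‖ = ‖z‖ := ContinuousLinearMap.norm_map_of_mem_unitary hW z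
  rw [hMy, ← hy]
  refine (sq_eq_sq₀ (norm_nonneg _) (norm_nonneg _)).1 ?_
  rw [@norm_sub_sq ℂ, @norm_sub_sq ℂ, norm_smul, norm_smul, hWz, inner_smul_right,
    inner_smul_right]
  congr 3
  exact (Complex.re_ofReal_mul _ _).trans
    ((congrArg (a * ·) (inner_re_symm (𝕜 := ℂ) (W z) z)).trans (Complex.re_ofReal_mul _ _).symm)


/-- Compression is linear but not multiplicative, so the product form has to be expanded into powers
of W. -/
theorem hasSum_mobius {K : Type*} [NormedAddCommGroup K] [InnerProductSpace ℂ K]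
    [CompleteSpace K] {W : K →L[ℂ] K} {a : ℂ} (h : ‖a • W‖ < 1) :
    HasSum (fun n : ℕ => a ^ n • W ^ (n + 1) - a ^ (n + 1) • W ^ n) (mobius a W) := by
  have hs : HasSum (fun n : ℕ => (a • W) ^ n) (∑' n : ℕ, (a • W) ^ n) :=
    (summable_geometric_of_norm_lt_one h).hasSum
  refine (hs.mul_left (W - a • 1)).congr_fun fun n => ?_
  rw [smul_pow, sub_mul, mul_smul_comm, smul_mul_smul_comm, one_mul, ← pow_succ', ← pow_succ']

/-- If the powers of `W` compress to the powers of `S`, then the Möbius transform of `W` compresses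
to that of `S`. -/
theorem compression_mobius {H K : Type*} [NormedAddCommGroup H] [InnerProductSpace ℂ H]
    [CompleteSpace H] [NormedAddCommGroup K] [InnerProductSpace ℂ K] [CompleteSpace K]
    {W : K →L[ℂ] K} {S : H →L[ℂ] H} {a : ℂ} (hW : ‖a • W‖ < 1) (hS : ‖a • S‖ < 1)
    (p : K →L[ℂ] H) (r : H →L[ℂ] K) (h : ∀ n : ℕ, S ^ n = p ∘L (W ^ n) ∘L r) :
    mobius a S = p ∘L mobius a W ∘L r := by
  let Φ : (K →L[ℂ] K) →L[ℂ] (H →L[ℂ] H) :=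
    (ContinuousLinearMap.compL ℂ H K H p).comp ((ContinuousLinearMap.compL ℂ H K K).flip r)
  have hΦ : ∀ X, Φ X = p ∘L X ∘L r := fun X => rfl
  refine ((hasSum_mobius hS).unique ?_).trans (hΦ _)
  refine ((hasSum_mobius hW).mapL Φ).congr_fun fun n => ?_
  rw [map_sub, map_smul, map_smul, hΦ, hΦ, ← h, ← h]

/-- The Möbius transform of `b (1 + cV)` at `b`, for `V` of square zero. -/
theorem mobius_squareZero {H : Type*} [NormedAddCommGroup H] [InnerProductSpace ℂ H]
    [CompleteSpace H] {V : H →L[ℂ] H} (hV : V * V = 0) {b c : ℂ} (hb : b ^ 2 ≠ 1)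
    (h : ‖b • (b • (1 + c • V))‖ < 1) :
    mobius b (b • (1 + c • V)) = (b * c / (1 - b ^ 2)) • V := by
  have hb' : 1 - b ^ 2 ≠ 0 := sub_ne_zero.2 hb.symm
  have h1 := mul_neg_geom_series _ h
  -- V² = 0 reduces the left side to bcV, so the geometric series cancels.
  have h2 : (b * c / (1 - b ^ 2)) • V * (1 - b • (b • (1 + c • V))) = b • (1 + c • V) - b • 1 := by
    simp only [smul_add, smul_smul, mul_sub, mul_add, mul_one, smul_mul_assoc, hV, smul_zero,
      add_zero, mul_smul_comm, add_sub_cancel_left, ← sub_smul]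
    congr 1
    field_simp
  rw [mobius, ← h2, mul_assoc, h1, mul_one]

/-! ### Approximate intertwining and commutators -/

/-- If an isometric operator compresses to `s V`, where `V` preserves the norm of `x` and `s` is
close to `1`, then the operator maps `x` close to `V x`. -/
theorem norm_sub_sq_le_of_compression {H K : Type*} [NormedAddCommGroup H]
    [InnerProductSpace ℂ H] [CompleteSpace H] [NormedAddCommGroup K] [InnerProductSpace ℂ K]
    [CompleteSpace K] {M : K →L[ℂ] K} (hM : ∀ y, ‖M y‖ = ‖y‖) {V : H →L[ℂ] H} {r : H →ₗᵢ[ℂ] K}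
    {s a : ℝ} (has : a ≤ s)
    (h : ContinuousLinearMap.adjoint r.toContinuousLinearMap ∘L M ∘L r.toContinuousLinearMap
      = (s : ℂ) • V) {x : H} (hx : ‖V x‖ = ‖x‖) :
    ‖M (r x) - r (V x)‖ ^ 2 ≤ 2 * (1 - a) * ‖x‖ ^ 2 := by
  have hin : inner ℂ (M (r x)) (r (V x)) = inner ℂ ((s : ℂ) • V x) (V x) := by
    have := congrArg (fun f : H →L[ℂ] H => inner ℂ (f x) (V x)) h
    simpa [ContinuousLinearMap.adjoint_inner_left] using this
  have hre : RCLike.re (inner ℂ (M (r x)) (r (V x))) = s * ‖x‖ ^ 2 := by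
    rw [hin, inner_smul_left, inner_self_eq_norm_sq_to_K, hx, Complex.conj_ofReal]
    refine (Complex.re_ofReal_mul s _).trans ?_
    norm_cast
  rw [@norm_sub_sq ℂ, hre, hM, r.norm_map, r.norm_map, hx]
  nlinarith [sq_nonneg ‖x‖]

/-- Commuting isometric operators that approximately map `f x` to `g x`, `g (u x)`, `g (v x)`
force `u` and `v` to commute approximately. -/
theorem norm_commutator_le {G K : Type*} [NormedAddCommGroup G] [InnerProductSpace ℂ G]
    [NormedAddCommGroup K] [InnerProductSpace ℂ K] {f : G →ₗᵢ[ℂ] K} {g : G → K}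
    {L M N : K →L[ℂ] K} (hL : ∀ y, ‖L y‖ = ‖y‖) (hM : ∀ y, ‖M y‖ = ‖y‖) (hN : ∀ y, ‖N y‖ = ‖y‖)
    (hLM : Commute L M) (hLN : Commute L N) (hMN : Commute M N) {u v : G → G}
    (hu : ∀ x, ‖u x‖ = ‖x‖) (hv : ∀ x, ‖v x‖ = ‖x‖) {δ : ℝ}
    (hfL : ∀ x, ‖L (f x) - g x‖ ≤ δ * ‖x‖) (hfM : ∀ x, ‖M (f x) - g (u x)‖ ≤ δ * ‖x‖)
    (hfN : ∀ x, ‖N (f x) - g (v x)‖ ≤ δ * ‖x‖) (x : G) :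
    ‖u (v x) - v (u x)‖ ≤ 8 * δ * ‖x‖ := by
  have h1 : ∀ x, dist (L (f (u x))) (M (f x)) ≤ 2 * δ * ‖x‖ := fun x => by
    have := hfL (u x)
    rw [hu, ← dist_eq_norm] at this
    have h' := hfM x
    rw [← dist_eq_norm] at h'
    linarith [dist_triangle_right (L (f (u x))) (M (f x)) (g (u x))]
  have h2 : ∀ x, dist (L (f (v x))) (N (f x)) ≤ 2 * δ * ‖x‖ := fun x => by
    have := hfL (v x)
    rw [hv, ← dist_eq_norm] at this
    have h' := hfN x
    rw [← dist_eq_norm] at h'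
    linarith [dist_triangle_right (L (f (v x))) (N (f x)) (g (v x))]
  have iso : ∀ {X : K →L[ℂ] K}, (∀ y, ‖X y‖ = ‖y‖) → ∀ y z, dist (X y) (X z) = dist y z :=
    fun hX y z => by rw [dist_eq_norm, ← map_sub, hX, dist_eq_norm]
  have app : ∀ {X Y : K →L[ℂ] K}, Commute X Y → ∀ y, X (Y y) = Y (X y) :=
    fun hXY y => congrArg (fun F : K →L[ℂ] K => F y) hXY
  -- L L f u v ≈ L M f v = M L f v ≈ M N f; exchanging the roles of u and v leads to the same M N f.
  have h3 : dist (L (L (f (u (v x))))) (M (N (f x))) ≤ 4 * δ * ‖x‖ := by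
    have e1 : dist (L (L (f (u (v x))))) (L (M (f (v x)))) ≤ 2 * δ * ‖x‖ := by
      rw [iso hL, ← hv x]; exact h1 _
    have e2 : dist (L (M (f (v x)))) (M (N (f x))) ≤ 2 * δ * ‖x‖ := by
      rw [app hLM, iso hM]; exact h2 x
    linarith [dist_triangle (L (L (f (u (v x))))) (L (M (f (v x)))) (M (N (f x)))]
  have h4 : dist (L (L (f (v (u x))))) (M (N (f x))) ≤ 4 * δ * ‖x‖ := by
    have e1 : dist (L (L (f (v (u x))))) (L (N (f (u x)))) ≤ 2 * δ * ‖x‖ := by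
      rw [iso hL, ← hu x]; exact h2 _
    have e2 : dist (L (N (f (u x)))) (M (N (f x))) ≤ 2 * δ * ‖x‖ := by
      rw [app hLN, app hMN, iso hN]; exact h1 x
    linarith [dist_triangle (L (L (f (v (u x))))) (L (N (f (u x)))) (M (N (f x)))]
  rw [← dist_eq_norm, ← f.isometry.dist_eq, ← iso hL, ← iso hL]
  linarith [dist_triangle_right (L (L (f (u (v x))))) (L (L (f (v (u x))))) (M (N (f x)))]


/-! ### Consequences of a dilation -/

theorem UnitaryRepReal.op_nat_mul {K : Type*} [NormedAddCommGroup K] [InnerProductSpace ℂ K]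
    [CompleteSpace K] (U : UnitaryRepReal K) (n : ℕ) (t : ℝ) : U.op (n * t) = U.op t ^ n := by
  induction n with
  | zero => simp [U.op_zero]
  | succ n ih => rw [Nat.cast_succ, add_mul, one_mul, U.op_add, ih, pow_succ]

theorem ContractiveC0Semigroup.op_nat_mul {H : Type*} [NormedAddCommGroup H]
    [InnerProductSpace ℂ H] (T : ContractiveC0Semigroup H) (n : ℕ) (t : ℝ≥0) :
    T.op (n * t) = T.op t ^ n := by
  induction n with
  | zero => simp [T.op_zero]
  | succ n ih => rw [Nat.cast_succ, add_mul, one_mul, T.op_add, ih, pow_succ]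

theorem CommutingFamily.prod_support_single {ι E X : Type*} [NormedAddCommGroup E]
    [InnerProductSpace ℂ E] {F : ι → X → E →L[ℂ] E} (hF : CommutingFamily F) (c : ℝ≥0 → X)
    (h0 : ∀ i, F i (c 0) = 1) (i : ι) (t : ℝ≥0) :
    (hF.prod (Finsupp.single i t).support fun j => c (Finsupp.single i t j)) = F i (c t) := by
  classical
  rcases eq_or_ne t 0 with rfl | ht
  · rw [h0]
    simp [CommutingFamily.prod]
  · simp [CommutingFamily.prod, Finsupp.support_single, ht]

/-- The Möbius transform at `e⁻ᵗ` of the time-`t` operator of a unitary dilation of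
`s ↦ e⁻ˢ (1 + 2sV)` almost maps `x` to `V x`, if `V` preserves the norm of `x`. -/
theorem norm_mobius_sub_le_of_dilation {H K : Type*} [NormedAddCommGroup H]
    [InnerProductSpace ℂ H] [CompleteSpace H] [NormedAddCommGroup K] [InnerProductSpace ℂ K]
    [CompleteSpace K] {V : H →L[ℂ] H} (hV : V * V = 0) (hn : ‖V‖ ≤ 1) {r : H →ₗᵢ[ℂ] K}
    {W : K →L[ℂ] K} (hW : W ∈ unitary (K →L[ℂ] K)) {t : ℝ≥0} (ht : 0 < t)
    (h : ∀ n : ℕ, (squareZeroSemigroup V hV hn).op t ^ n =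
      ContinuousLinearMap.adjoint r.toContinuousLinearMap ∘L (W ^ n) ∘L r.toContinuousLinearMap)
    {x : H} (hx : ‖V x‖ = ‖x‖) :
    ‖mobius (Real.exp (-t) : ℝ) W (r x) - r (V x)‖ ≤ √(2 * t) * ‖x‖ := by
  have ht' : (0 : ℝ) < t := ht
  set a := Real.exp (-t) with ha
  have ha0 : 0 < a := Real.exp_pos _
  have ha1 : a < 1 := by simpa [ha] using ht'
  have ha2 : a ^ 2 < 1 := by nlinarith
  have hS : ‖(a : ℂ) • (squareZeroSemigroup V hV hn).op t‖ < 1 := by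
    rw [norm_smul, Complex.norm_real, Real.norm_of_nonneg ha0.le]
    nlinarith [(squareZeroSemigroup V hV hn).norm_op_le t]
  have hc := compression_mobius (norm_smul_unitary_lt_one hW ha0.le ha1) hS _ _ h
  have hm : mobius (a : ℂ) ((squareZeroSemigroup V hV hn).op t)
      = ((a : ℂ) * ((2 * t : ℝ) : ℂ) / (1 - (a : ℂ) ^ 2)) • V :=
    mobius_squareZero hV (by exact_mod_cast ha2.ne) hS
  have hs : (a : ℂ) * ((2 * t : ℝ) : ℂ) / (1 - (a : ℂ) ^ 2)
      = ((a * (2 * t) / (1 - a ^ 2) : ℝ) : ℂ) := by push_cast; rfl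
  rw [hm, hs] at hc
  -- This is 1 - e⁻²ᵗ ≤ 2t.
  have has : a ≤ a * (2 * t) / (1 - a ^ 2) := by
    rw [le_div_iff₀ (by linarith)]
    have : 1 - 2 * (t : ℝ) ≤ a ^ 2 := by
      rw [ha, ← Real.exp_nat_mul]
      have := Real.add_one_le_exp (((2 : ℕ) : ℝ) * -(t : ℝ))
      push_cast at this ⊢
      linarith
    gcongr
    linarith
  have hat : 1 - (t : ℝ) ≤ a := by linarith [Real.add_one_le_exp (-(t : ℝ))]
  refine le_of_sq_le_sq ?_ (by positivity)
  rw [mul_pow, Real.sq_sqrt (by positivity)]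
  refine (norm_sub_sq_le_of_compression (norm_mobius_apply hW ha0.le ha1) has hc.symm hx).trans ?_
  gcongr
  linarith

/-! ### Parrott's operators -/

/-- An infinite-dimensional Hilbert space contains two orthogonal isometric copies of `ℂ²`. -/
theorem exists_orthogonal_isometries {H : Type*} [NormedAddCommGroup H] [InnerProductSpace ℂ H]
    [CompleteSpace H] (hH : ¬ FiniteDimensional ℂ H) :
    ∃ J₀ J₁ : EuclideanSpace ℂ (Fin 2) →ₗᵢ[ℂ] H, ∀ x y, inner ℂ (J₀ x) (J₁ y) = 0 := by
  obtain ⟨s, b, -⟩ := exists_hilbertBasis ℂ H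
  have hs : Infinite s := by
    by_contra hfin
    rw [not_infinite_iff_finite] at hfin
    have := Fintype.ofFinite s
    exact hH b.toOrthonormalBasis.toBasis.finiteDimensional_of_finite
  have e : Fin 2 × Fin 2 ↪ s := (Fintype.equivFin _).toEmbedding.trans
    (Fin.valEmbedding.trans (Infinite.natEmbedding s))
  have hv : Orthonormal ℂ (b ∘ e) := b.orthonormal.comp e e.injective
  have hJ : ∀ k, ∃ J : EuclideanSpace ℂ (Fin 2) →ₗᵢ[ℂ] H, ∀ x, J x = ∑ j, x j • b (e (k, j)) := by
    intro k
    let B := (EuclideanSpace.basisFun (Fin 2) ℂ)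
    refine ⟨(B.toBasis.constr ℂ fun j => b (e (k, j))).isometryOfOrthonormal
      (v := B.toBasis) (by simp) ?_, fun x => ?_⟩
    · convert hv.comp (fun j => (k, j)) (Prod.mk_right_injective k) using 1
      ext j
      simp
    · refine (Module.Basis.constr_apply_fintype ℂ B.toBasis _ x).trans ?_
      simp [B]
  choose J hJ using hJ
  refine ⟨J 0, J 1, fun x y => ?_⟩
  rw [hJ, hJ, sum_inner]
  refine Finset.sum_eq_zero fun i _ => ?_
  rw [inner_sum]
  refine Finset.sum_eq_zero fun j _ => ?_
  have : inner ℂ (b (e (0, i))) (b (e (1, j))) = 0 := hv.2 (by simp)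
  rw [inner_smul_left, inner_smul_right, this, mul_zero, mul_zero]

/-- The Pauli matrices X and Z are self-adjoint involutions that anticommute. -/
theorem exists_noncommuting_unitaries :
    ∃ X ∈ unitary (EuclideanSpace ℂ (Fin 2) →L[ℂ] EuclideanSpace ℂ (Fin 2)),
      ∃ Z ∈ unitary (EuclideanSpace ℂ (Fin 2) →L[ℂ] EuclideanSpace ℂ (Fin 2)), ¬ Commute X Z := by
  let φ := Matrix.toEuclideanCLM (n := Fin 2) (𝕜 := ℂ)
  have hu : ∀ {A : Matrix (Fin 2) (Fin 2) ℂ}, star A = A → A * A = 1 →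
      φ A ∈ unitary (EuclideanSpace ℂ (Fin 2) →L[ℂ] EuclideanSpace ℂ (Fin 2)) := by
    intro A h1 h2
    rw [Unitary.mem_iff, ← map_star, h1, ← map_mul, h2, map_one]
    exact ⟨rfl, rfl⟩
  refine ⟨φ !![0, 1; 1, 0], hu ?_ ?_, φ !![1, 0; 0, -1], hu ?_ ?_, fun h => ?_⟩
  · ext i j; fin_cases i <;> fin_cases j <;> simp [Matrix.star_apply]
  · simp [Matrix.one_fin_two]
  · ext i j; fin_cases i <;> fin_cases j <;> simp [Matrix.star_apply]
  · simp [Matrix.one_fin_two]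
  · have h' := φ.injective ((map_mul φ _ _).trans (h.eq.trans (map_mul φ _ _).symm))
    have := congrFun (congrFun h' 0) 1
    norm_num [Matrix.mul_apply] at this

/-- The operator that maps the range of `J₀` to that of `J₁` by `J₀ x ↦ J₁ (u x)` and vanishes on
the orthogonal complement of the range of `J₀`. -/
noncomputable def transfer {G H : Type*} [NormedAddCommGroup G] [InnerProductSpace ℂ G]
    [CompleteSpace G] [NormedAddCommGroup H] [InnerProductSpace ℂ H] [CompleteSpace H]
    (J₀ J₁ : G →ₗᵢ[ℂ] H) (u : G →L[ℂ] G) : H →L[ℂ] H :=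
  J₁.toContinuousLinearMap ∘L u ∘L ContinuousLinearMap.adjoint J₀.toContinuousLinearMap

section transfer

variable {G H : Type*} [NormedAddCommGroup G] [InnerProductSpace ℂ G]
  [CompleteSpace G] [NormedAddCommGroup H] [InnerProductSpace ℂ H] [CompleteSpace H]
  {J₀ J₁ : G →ₗᵢ[ℂ] H}

/-- The range of J₁ is killed by the adjoint of J₀. -/
theorem transfer_mul_transfer (hJ : ∀ x y, inner ℂ (J₀ x) (J₁ y) = 0) (u v : G →L[ℂ] G) :
    transfer J₀ J₁ u * transfer J₀ J₁ v = 0 := by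
  have h : ∀ y, ContinuousLinearMap.adjoint J₀.toContinuousLinearMap (J₁ y) = 0 := fun y =>
    ext_inner_left ℂ fun x => by
      rw [ContinuousLinearMap.adjoint_inner_right, inner_zero_right]
      exact hJ x y
  ext x
  simp [transfer, h]

theorem norm_transfer_le {u : G →L[ℂ] G} (hu : u ∈ unitary (G →L[ℂ] G)) :
    ‖transfer J₀ J₁ u‖ ≤ 1 := by
  refine ContinuousLinearMap.opNorm_le_bound _ zero_le_one fun x => ?_
  have h : ‖transfer J₀ J₁ u x‖
      = ‖ContinuousLinearMap.adjoint J₀.toContinuousLinearMap x‖ := by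
    simp [transfer, ContinuousLinearMap.norm_map_of_mem_unitary hu]
  rw [h]
  refine ContinuousLinearMap.le_of_opNorm_le _ ?_ x
  rw [LinearIsometryEquiv.norm_map]
  exact J₀.norm_toContinuousLinearMap_le

theorem transfer_apply (u : G →L[ℂ] G) (x : G) : transfer J₀ J₁ u (J₀ x) = J₁ (u x) := by
  have h : ContinuousLinearMap.adjoint J₀.toContinuousLinearMap (J₀ x) = x :=
    ext_inner_left ℂ fun y => by
      rw [ContinuousLinearMap.adjoint_inner_right]
      exact J₀.inner_map_map y x
  simp [transfer, h]

end transfer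

theorem squareZeroSemigroup_commute {H : Type*} [NormedAddCommGroup H] [InnerProductSpace ℂ H]
    [CompleteSpace H] {V V' : H →L[ℂ] H} (hV : V * V = 0) (hn : ‖V‖ ≤ 1) (hV' : V' * V' = 0)
    (hn' : ‖V'‖ ≤ 1) (h : Commute V V') (s t : ℝ≥0) :
    Commute ((squareZeroSemigroup V hV hn).op s) ((squareZeroSemigroup V' hV' hn').op t) := by
  have h1 : Commute (1 + ((2 * s : ℝ) : ℂ) • V) (1 + ((2 * t : ℝ) : ℂ) • V') :=
    (Commute.one_left _).add_left
      ((Commute.one_right _).add_right ((h.smul_left _).smul_right _))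
  exact (h1.smul_left _).smul_right _

/-! ### The contradiction -/

/-- If the semigroups `t ↦ e⁻ᵗ (1 + 2tV)` with `V = transfer J₀ J₁ (u i)` have a simultaneous
unitary dilation and `u c = 1` for some `c`, then the unitaries `u i` commute. -/
theorem commute_of_hasSimultaneousUnitaryDilation {G : Type*} [NormedAddCommGroup G]
    [InnerProductSpace ℂ G] [CompleteSpace G] {H : Type u} [NormedAddCommGroup H]
    [InnerProductSpace ℂ H] [CompleteSpace H] {J₀ J₁ : G →ₗᵢ[ℂ] H}
    (hJ : ∀ x y, inner ℂ (J₀ x) (J₁ y) = 0) {ι : Type v} {u : ι → G →L[ℂ] G}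
    (hu : ∀ i, u i ∈ unitary (G →L[ℂ] G))
    (hT : CommutingFamily fun i => (squareZeroSemigroup (transfer J₀ J₁ (u i))
      (transfer_mul_transfer hJ _ _) (norm_transfer_le (hu i))).op)
    (hdil : HasSimultaneousUnitaryDilation.{u, v, w} _ hT) {c : ι} (hc : u c = 1) (i j : ι) :
    Commute (u i) (u j) := by
  obtain ⟨K, _, _, _, U, hU, r, h⟩ := hdil
  have hs : ∀ i (t : ℝ≥0), (squareZeroSemigroup (transfer J₀ J₁ (u i))
      (transfer_mul_transfer hJ _ _) (norm_transfer_le (hu i))).op t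
      = ContinuousLinearMap.adjoint r.toContinuousLinearMap ∘L (U i).op t ∘L
          r.toContinuousLinearMap := by
    intro i t
    -- Only one-index instances of the dilation identity are needed; the indices interact through
    -- the commutativity of U.
    have h' := h (Finsupp.single i t)
    rw [hU.prod_support_single (fun t : ℝ≥0 => (t : ℝ)) (fun i => (U i).op_zero)] at h'
    exact (hT.prod_support_single id (fun i => ContractiveC0Semigroup.op_zero _) i t).symm.trans h'
  have hu' : ∀ i x, ‖u i x‖ = ‖x‖ := fun i x =>
    ContinuousLinearMap.norm_map_of_mem_unitary (hu i) x
  have key : ∀ x, ∀ t : ℝ≥0, 0 < t →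
      ‖u i (u j x) - u j (u i x)‖ ≤ 8 * √(2 * t) * ‖x‖ := by
    intro x t ht
    have ht' : (0 : ℝ) < t := ht
    have ha0 : 0 ≤ Real.exp (-t) := (Real.exp_pos _).le
    have ha1 : Real.exp (-t) < 1 := by simpa using ht'
    have near : ∀ i x, ‖mobius (Real.exp (-t) : ℝ) ((U i).op t) (r (J₀ x)) - r (J₁ (u i x))‖
        ≤ √(2 * t) * ‖x‖ := by
      intro i x
      rw [← J₀.norm_map x, ← transfer_apply]
      refine norm_mobius_sub_le_of_dilation (transfer_mul_transfer hJ _ _)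
        (norm_transfer_le (hu i)) ((U i).op_mem_unitary t) ht (fun n => ?_) ?_
      · rw [← ContractiveC0Semigroup.op_nat_mul, hs, ← UnitaryRepReal.op_nat_mul]
        simp
      · rw [transfer_apply, J₁.norm_map, J₀.norm_map, hu']
    have comm : ∀ i j, Commute (mobius (Real.exp (-t) : ℝ) ((U i).op t))
        (mobius (Real.exp (-t) : ℝ) ((U j).op t)) := fun i j => (hU i j t t).mobius _ _
    have iso : ∀ i y, ‖mobius (Real.exp (-t) : ℝ) ((U i).op t) y‖ = ‖y‖ := fun i =>
      norm_mobius_apply ((U i).op_mem_unitary t) ha0 ha1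
    exact norm_commutator_le (f := r.comp J₀) (g := fun x => r (J₁ x)) (iso c) (iso i) (iso j)
      (comm c i) (comm c j) (comm i j) (hu' i) (hu' j)
      (fun x => by simpa [hc] using near c x) (near i) (near j) x
  ext1 x
  refine sub_eq_zero.1 (norm_le_zero_iff.1 ?_)
  have hlim : Tendsto (fun t : ℝ≥0 => 8 * √(2 * t) * ‖x‖) (𝓝[>] 0) (𝓝 0) := by
    have : Continuous fun t : ℝ≥0 => 8 * √(2 * t) * ‖x‖ := by fun_prop
    exact (this.tendsto' 0 0 (by simp)).mono_left nhdsWithin_le_nhds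
  exact ge_of_tendsto hlim (eventually_mem_nhdsWithin.mono fun t ht => key x t ht)

theorem mainTheorem1 {H : Type u} [NormedAddCommGroup H] [InnerProductSpace ℂ H] [CompleteSpace H]
    (hH : ¬ FiniteDimensional ℂ H) {ι : Type v} (hι : 3 ≤ Cardinal.mk ι) :
    ∃ (T : ι → ContractiveC0Semigroup H) (hT : CommutingFamily fun i => (T i).op),
      (∀ i, (T i).HasBoundedGenerator) ∧
        ¬ HasSimultaneousUnitaryDilation.{u, v, w} T hT := by
  classical
  obtain ⟨J₀, J₁, hJ⟩ := exists_orthogonal_isometries hH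
  obtain ⟨X, hX, Z, hZ, hXZ⟩ := exists_noncommuting_unitaries
  have : Nonempty ι := Cardinal.mk_ne_zero_iff.1 fun h => by simp [h] at hι
  let i₀ : ι := Classical.arbitrary ι
  obtain ⟨i₁, h₁, -⟩ := Cardinal.exists_ne_ne_of_three_le hι i₀ i₀
  obtain ⟨i₂, h₂₀, h₂₁⟩ := Cardinal.exists_ne_ne_of_three_le hι i₀ i₁
  let u : ι → EuclideanSpace ℂ (Fin 2) →L[ℂ] EuclideanSpace ℂ (Fin 2) :=
    -- Every index other than i₀ and i₁ gets the identity; i₂ ensures there is one.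
    fun i => if i = i₀ then X else if i = i₁ then Z else 1
  have hu : ∀ i, u i ∈ unitary (EuclideanSpace ℂ (Fin 2) →L[ℂ] EuclideanSpace ℂ (Fin 2)) := by
    intro i
    simp only [u]
    split_ifs
    exacts [hX, hZ, one_mem _]
  refine ⟨fun i => squareZeroSemigroup (transfer J₀ J₁ (u i)) (transfer_mul_transfer hJ _ _)
    (norm_transfer_le (hu i)), fun i j s t => squareZeroSemigroup_commute _ _ _ _ ?_ s t,
    fun i => squareZeroSemigroup_hasBoundedGenerator _ _ _, fun hdil => hXZ ?_⟩
  · exact (transfer_mul_transfer hJ _ _).trans (transfer_mul_transfer hJ _ _).symm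
  · have := commute_of_hasSimultaneousUnitaryDilation hJ hu _ hdil (c := i₂)
      (by simp [u, h₂₀, h₂₁]) i₀ i₁
    simpa [u, h₁] using this
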